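/- **Setting.** Let $K$ be a field that is complete with respect to a non-trivial non-Archimedean absolute value $|\cdot|$. Let $\mathcal A$ be an algebra of subsets of a set $X$ that separates the points of $X$ (for $a\neq b$ there is $A\in\mathcal A$ with $a\in A$, $b\notin A$); give $X$ the topology with base $\mathcal A$. Let $\mu:\mathcal A\to K$ be a measure, i.e. $\mu$ is additive on disjoint sets; $\|A\|_\mu:=\sup\{|\mu(B)|: B\subset A,\ B\in\mathcal A\}<\infty$ for $A\in\mathcal A$; and every non-empty family $\mathcal A_0\subset\mathcal A$ that is closed under intersections of two members and has empty intersection contains, for each $\epsilon>0$, a set $A$ with $|\mu(A)|<\epsilon$. For a set function $m$ with values in $K$ on a family $\mathcal R$ of sets put $N_m(x)=\inf\{\|A\|_m: x\in A\in\mathcal R\}$ and $\|f\|_m=\sup_x|f(x)|N_m(x)$, for $K$-valued functions $f$. A simple function is a finite sum $g=\sum_j x_j\chi_{A_j}$ with $x_j\in K$, $A_j\in\mathcal R$, and $\int g\,dm=\sum_j x_j m(A_j)$. A function $f$ is $m$-integrable if $\|f-f_n\|_m\to0$ for some sequence of simple functions $f_n$; then $\int f\,dm:=\lim_n\int f_n\,dm$,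 for every such sequence. $\mathcal A_\mu$ is the family of all $A\subset X$ such that for each $\epsilon>0$ there is $B_\epsilon\in\mathcal A$ with $N_\mu\le\epsilon$ on $A\,\triangle\,B_\epsilon$, and $\mu$ is extended to $\mathcal A_\mu$ by $\mu(A)=\lim_{\epsilon\to0}\mu(B_\epsilon)$. **Nonstandard extension.** Let ${}^*$ be the nonstandard extension given by ultrapowers with respect to a countably incomplete ultrafilter (so it is countably saturated). Write $u\approx v$ if $u-v$ is infinitesimal. For a topological space $T$, $z\in{}^*T$ is nearstandard with standard part $a\in T$ if $z\in{}^*A$ for every open $A\ni a$; $\mathrm{st}_K$ is the standard-part map of $K$. Assume that all values of ${}^*\mu$ on ${}^*\mathcal A$ are nearstandard in ${}^*K$. **Hyperfinite space.** Let $Y$ be the set of classes of an internal hyperfinite partition of ${}^*X$ into members of ${}^*\mathcal A$. Let $\mathcal S$ be the algebra of all internal subsets of $Y$, and for $B\in\mathcal S$ let $\nu(B)\in{}^*K$ be the ${}^*\mu$-measure of the union of the classes in $B$. The internal quantities $\|A\|_\nu$, $N_\nu$ and $\|F\|_\nu$ (for internal $F:Y\to{}^*K$) are defined as above. A set $A\subset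 Y$ is Loeb null if $N_\nu(y)\approx0$ for all $y\in A$; $\mathcal S_L$ is the family of all $A\subset Y$ for which some $B\in\mathcal S$ has $A\,\triangle\,B$ Loeb null, and then $\nu_L(A):=\mathrm{st}_K(\nu(B))$. Put $\mathrm{st}_Y(y)=a$ if all elements of the class $y$ are nearstandard in ${}^*X$ with standard part $a\in X$. "Almost everywhere" means outside a Loeb null set. Functions that are only defined almost everywhere are extended by $0$. Assume that $(X,\mathcal A_\mu,\mu)$ is the push-down of $(Y,\mathcal S_L,\nu_L)$ via $\mathrm{st}_Y$: the map $\mathrm{st}_Y$ is defined almost everywhere; a set $A\subset X$ lies in $\mathcal A_\mu$ if and only if $\mathrm{st}_Y^{-1}(A)\in\mathcal S_L$; and $\mu(A)=\nu_L(\mathrm{st}_Y^{-1}(A))$ for $A\in\mathcal A_\mu$. For internal $F:Y\to{}^*K$ let $\int_Y F\,d\nu=\sum_{y\in Y}F(y)\,\nu(\{y\})$ (a hyperfinite sum). $F$ is called $S$-integrable if (a) $\|F\|_\nu$ is finite; (b) $\|F\chi_A\|_\nu\approx0$ for every $A\in\mathcal S$ with $\|A\|_\nu\approx0$; (c) $\|F\chi_A\|_\nu\approx0$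 for every $A\in\mathcal S$ such that $F(y)\chi_A(y)\approx0$ for all $y\in Y$. **Theorem.** Let $f:X\to K$ be $\mu$-integrable. Then $f\circ\mathrm{st}_Y$ is integrable with respect to $(Y,\mathcal S_L,\nu_L)$, and there is an $S$-integrable internal function $F:Y\to{}^*K$ such that, for almost every $y$, $F(y)$ is nearstandard and $f(\mathrm{st}_Y(y))=\mathrm{st}_K(F(y))$. Moreover $\mathrm{st}_K\circ F$ is integrable with respect to $\nu_L$, $\int_Y F\,d\nu$ is nearstandard in ${}^*K$, and $$\int_X f\,d\mu=\int_Y f(\mathrm{st}_Y(y))\,d\nu_L=\int_Y\mathrm{st}_K(F(y))\,d\nu_L=\mathrm{st}_K\int_Y F\,d\nu .$$ -/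

import Mathlib

open Filter Topology
open scoped ENNReal NNReal

noncomputable section

namespace NonArch

/-! ### Standard measure spaces and integrals with values in a non-Archimedean field -/

section Standard

variable {X K : Type*} [NontriviallyNormedField K]

/-- `‖A‖_μ = sup { |μ(B)| : B ⊆ A, B ∈ R }`, in `[0, ∞]`. Only the values of `μ` on `R` matter. -/
def setNorm (R : Set (Set X)) (μ : Set X → K) (A : Set X) : ℝ≥0∞ :=
  ⨆ B ∈ {B : Set X | B ∈ R ∧ B ⊆ A}, ‖μ B‖ₑ

/-- The norm function `N_μ(x) = inf { ‖A‖_μ : x ∈ A ∈ R }`. -/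
def normFun (R : Set (Set X)) (μ : Set X → K) (x : X) : ℝ≥0∞ :=
  ⨅ A ∈ {A : Set X | A ∈ R ∧ x ∈ A}, setNorm R μ A

/-- The seminorm `‖f‖_μ = sup_x |f(x)| N_μ(x)`, in `[0, ∞]`. -/
def funNorm (R : Set (Set X)) (μ : Set X → K) (f : X → K) : ℝ≥0∞ :=
  ⨆ x, ‖f x‖ₑ * normFun R μ x

/-- A family of sets is separating if it separates any two distinct points. -/
def IsSeparating (R : Set (Set X)) : Prop :=
  ∀ a b : X, a ≠ b → ∃ A ∈ R, a ∈ A ∧ b ∉ A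

/-- `μ` is a `K`-valued measure on the ring `R`: additive, bounded and continuous. -/
structure IsMeasure (R : Set (Set X)) (μ : Set X → K) : Prop where
  additive : ∀ A ∈ R, ∀ B ∈ R, Disjoint A B → μ (A ∪ B) = μ A + μ B
  bounded : ∀ A ∈ R, setNorm R μ A < ∞
  continuous : ∀ R₀ ⊆ R, R₀.Nonempty → (∀ A ∈ R₀, ∀ B ∈ R₀, A ∩ B ∈ R₀) → ⋂₀ R₀ = ∅ →
    ∀ ε : ℝ, 0 < ε → ∃ A ∈ R₀, ‖μ A‖ < ε

/-- The extended family `R_μ`: the sets that are approximated by members of `R`. -/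
def extended (R : Set (Set X)) (μ : Set X → K) : Set (Set X) :=
  {A | ∀ ε : ℝ≥0, 0 < ε → ∃ B ∈ R, ∀ x ∈ symmDiff A B, normFun R μ x ≤ ε}

/-- `c` is the value `lim_{ε → 0} μ(B_ε)` at `A` of the extension of `μ` to `R_μ`,
where `B_ε ∈ R` and `N_μ ≤ ε` on the symmetric difference of `A` and `B_ε`. -/
def IsExtendedValue (R : Set (Set X)) (μ : Set X → K) (A : Set X) (c : K) : Prop :=
  ∀ ε : ℝ≥0, 0 < ε → ∃ B ∈ R, (∀ x ∈ symmDiff A B, normFun R μ x ≤ ε) ∧ ‖μ B - c‖ₑ ≤ ε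

/-- An `R`-simple function, presented as `∑_j coef_j χ_{sets_j}` with `sets_j ∈ R`. -/
structure SimpleFun (R : Set (Set X)) (K : Type*) where
  n : ℕ
  coef : Fin n → K
  sets : Fin n → Set X
  mem : ∀ j, sets j ∈ R

/-- The function `∑_j coef_j χ_{sets_j}`. -/
def SimpleFun.toFun {R : Set (Set X)} (g : SimpleFun R K) (x : X) : K :=
  ∑ j, (g.sets j).indicator (fun _ => g.coef j) x

/-- The integral `∑_j coef_j μ(sets_j)`. -/
def SimpleFun.integral {R : Set (Set X)} (g : SimpleFun R K) (μ : Set X → K) : K :=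
  ∑ j, g.coef j * μ (g.sets j)

/-- The sequence `g` of simple functions converges to `f` with respect to `‖ ‖_μ`. -/
def Approximates (R : Set (Set X)) (μ : Set X → K) (g : ℕ → SimpleFun R K) (f : X → K) : Prop :=
  Tendsto (fun n => funNorm R μ (fun x => f x - (g n).toFun x)) atTop (𝓝 0)

/-- `f` is integrable if it is a limit of simple functions with respect to `‖ ‖_μ`. -/
def IsIntegrable (R : Set (Set X)) (μ : Set X → K) (f : X → K) : Prop :=
  ∃ g : ℕ → SimpleFun R K, Approximates R μ g f

open Classical in
/-- The integral of `f`: the common limit of the integrals of all sequences of simple functions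
that converge to `f` (and `0` if there is no such common limit). -/
def integral (R : Set (Set X)) (μ : Set X → K) (f : X → K) : K :=
  if h : ∃ c : K, ∀ g : ℕ → SimpleFun R K, Approximates R μ g f →
      Tendsto (fun n => (g n).integral μ) atTop (𝓝 c)
  then h.choose else 0

end Standard

/-! ### Nonstandard extensions by ultrapowers

For an ultrafilter `U` on `I`, the extension of a set `T` is `Germ U T`; the internal set
represented by a family `Ω i` is the ultraproduct `Product U Ω`. -/

section Nonstandard

variable {I : Type*} (U : Ultrafilter I)

/-- `U` is countably incomplete; equivalently, its ultrapowers are countably saturated. -/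
def IsCountablyIncomplete : Prop :=
  ∃ s : ℕ → Set I, (∀ n, s n ∈ U) ∧ ⋂ n, s n = ∅

variable {U}

/-- The internal function on the internal set `∏_U Ω i` represented by a family of functions. -/
def starMap {Ω : I → Type*} {T : Type*} (F : ∀ i, Ω i → T) :
    Product (U : Filter I) Ω → Germ (U : Filter I) T :=
  Quotient.map' (s₁ := productSetoid (U : Filter I) Ω) (fun y i => F i (y i))
    (fun _ _ h => h.mono fun i hi => congrArg (F i) hi)

variable (U) in
/-- The internal subset of `∏_U Ω i` represented by a family of sets `B i ⊆ Ω i`. -/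
def internalSet {Ω : I → Type*} (B : ∀ i, Set (Ω i)) : Set (Product (U : Filter I) Ω) :=
  {y | (starMap (fun i a => a ∈ B i) y).LiftPred (fun p => p)}

/-- The monad of a point `a` of a topological space `T`: the intersection of the extensions of all
open sets that contain `a`. -/
def monad {T : Type*} (t : TopologicalSpace T) (a : T) : Set (Germ (U : Filter I) T) :=
  {z | ∀ A : Set T, IsOpen[t] A → a ∈ A → z.LiftPred (· ∈ A)}

/-- `z ∈ *T` is nearstandard. -/
def IsNearstandard {T : Type*} [t : TopologicalSpace T] (z : Germ (U : Filter I) T) : Prop :=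
  ∃ a : T, z ∈ monad t a

open Classical in
/-- The standard-part map of `K`, extended by `0` to elements that are not nearstandard. -/
def stK {K : Type*} [NontriviallyNormedField K] (z : Germ (U : Filter I) K) : K :=
  if h : ∃ a : K, z ∈ monad inferInstance a then h.choose else 0

/-- An element of `*[0, ∞]` is infinitesimal. -/
def Infinitesimal (r : Germ (U : Filter I) ℝ≥0∞) : Prop :=
  ∀ ε : ℝ≥0, 0 < ε → r.LiftPred (· ≤ (ε : ℝ≥0∞))

/-- An element of `*[0, ∞]` is a finite hyperreal number. -/
def IsFinite (r : Germ (U : Filter I) ℝ≥0∞) : Prop :=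
  ∃ C : ℝ≥0, r.LiftPred (· ≤ (C : ℝ≥0∞))

/-! ### Hyperfinite measure spaces and their Loeb spaces

A hyperfinite measure space is represented by finite sets `Ω i` and finitely additive functions
`ν i` on all subsets of `Ω i`. Its measurable sets are all internal subsets of `∏_U Ω i`. -/

section Loeb

variable {K : Type*} [NontriviallyNormedField K] {Ω : I → Type*}

/-- The internal norm function `N_ν`. -/
def starNormFun (ν : ∀ i, Set (Ω i) → K) (y : Product (U : Filter I) Ω) :
    Germ (U : Filter I) ℝ≥0∞ :=
  starMap (fun i => normFun Set.univ (ν i)) y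

/-- The internal number `‖A‖_ν` of the internal set represented by `A`. -/
def starSetNorm (ν : ∀ i, Set (Ω i) → K) (A : ∀ i, Set (Ω i)) : Germ (U : Filter I) ℝ≥0∞ :=
  ((fun i => setNorm Set.univ (ν i) (A i) : I → ℝ≥0∞) : Germ (U : Filter I) ℝ≥0∞)

/-- The internal seminorm `‖F‖_ν` of the internal function represented by `F`. -/
def starFunNorm (ν : ∀ i, Set (Ω i) → K) (F : ∀ i, Ω i → K) : Germ (U : Filter I) ℝ≥0∞ :=
  ((fun i => funNorm Set.univ (ν i) (F i) : I → ℝ≥0∞) : Germ (U : Filter I) ℝ≥0∞)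

/-- The value `ν(A) ∈ *K` at the internal set represented by `A`. -/
def starValue (ν : ∀ i, Set (Ω i) → K) (A : ∀ i, Set (Ω i)) : Germ (U : Filter I) K :=
  ((fun i => ν i (A i) : I → K) : Germ (U : Filter I) K)

/-- Loeb null sets: `N_ν(y)` is infinitesimal at all their points. -/
def IsLoebNull (ν : ∀ i, Set (Ω i) → K) (A : Set (Product (U : Filter I) Ω)) : Prop :=
  ∀ y ∈ A, Infinitesimal (starNormFun ν y)

variable (U) in
/-- The Loeb-measurable sets: they differ from an internal set by a Loeb null set. -/
def loebSets (ν : ∀ i, Set (Ω i) → K) : Set (Set (Product (U : Filter I) Ω)) :=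
  {A | ∃ B : ∀ i, Set (Ω i), IsLoebNull ν (symmDiff A (internalSet U B))}

open Classical in
variable (U) in
/-- The Loeb measure: `ν_L(A) = st_K(ν(B))`, where `B` is internal and `A` and `B` differ by a
Loeb null set. -/
def loebMeasure (ν : ∀ i, Set (Ω i) → K) (A : Set (Product (U : Filter I) Ω)) : K :=
  if h : ∃ B : ∀ i, Set (Ω i), IsLoebNull ν (symmDiff A (internalSet U B))
  then stK (starValue (U := U) ν h.choose) else 0

variable (U) in
/-- The integral of an internal function `F` over a hyperfinite space, that is, the integral
`∑_y F(y) ν({y})` of the `*`-simple function `F = ∑_y F(y) χ_{y}`. -/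
def starIntegral [∀ i, Fintype (Ω i)] (ν : ∀ i, Set (Ω i) → K) (F : ∀ i, Ω i → K) :
    Germ (U : Filter I) K :=
  ((fun i => ∑ y : Ω i, F i y * ν i {y} : I → K) : Germ (U : Filter I) K)

variable (U) in
/-- S-integrability of an internal function on a hyperfinite space (all such functions are
`*`-simple). Condition `pointwise` concerns internal sets `A` with `F(y) χ_A(y) ≈ 0` for all
`y`. -/
structure IsSIntegrable (ν : ∀ i, Set (Ω i) → K) (F : ∀ i, Ω i → K) : Prop where
  finite : IsFinite (starFunNorm (U := U) ν F)
  small : ∀ A : ∀ i, Set (Ω i), Infinitesimal (starSetNorm (U := U) ν A) →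
    Infinitesimal (starFunNorm (U := U) ν (fun i => (A i).indicator (F i)))
  pointwise : ∀ A : ∀ i, Set (Ω i),
    (∀ y : Product (U : Filter I) Ω,
      starMap (fun i => (A i).indicator (F i)) y ∈ monad inferInstance (0 : K)) →
    Infinitesimal (starFunNorm (U := U) ν (fun i => (A i).indicator (F i)))

end Loeb

/-! ### The hyperfinite quotient of `*X` by an internal partition

An internal hyperfinite partition of `*X` is represented by finite partitions `P i` of `X`. The
quotient `Y` of `*X` by the induced equivalence relation is the internal set of its classes. -/

section Quotient

variable {X K : Type*} [NontriviallyNormedField K]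

/-- The classes of the finite partition `P i`. -/
abbrev Cls (P : I → Finpartition (Set.univ : Set X)) (i : I) : Type _ :=
  {C : Set X // C ∈ (P i).parts}

variable (U) in
/-- The hyperfinite set `Y` of partition classes of `*X`. -/
abbrev Y (P : I → Finpartition (Set.univ : Set X)) : Type _ :=
  Product (U : Filter I) (Cls P)

/-- The partition class `y`, as a subset of `*X`. -/
def classSet (P : I → Finpartition (Set.univ : Set X)) (y : Y U P) : Set (Germ (U : Filter I) X) :=
  {z | Germ.LiftRel (· ∈ ·) z (starMap (fun _ (C : {C : Set X // C ∈ _}) => (C : Set X)) y)}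

/-- The measure on `Y` induced by `*μ`: the `*μ`-measure of a union of partition classes. -/
def quotMeasure (μ : Set X → K) (P : I → Finpartition (Set.univ : Set X)) (i : I)
    (B : Set (Cls P i)) : K :=
  μ (⋃ C ∈ B, (C : Set X))

/-- `st_Y(y) = a`: all elements of the class `y` are nearstandard with standard part `a`, for the
topology on `X` that is generated by `R`. -/
def IsStY (R : Set (Set X)) (P : I → Finpartition (Set.univ : Set X)) (y : Y U P) (a : X) : Prop :=
  classSet P y ⊆ monad (TopologicalSpace.generateFrom R) a

variable (U) in
/-- The preimage of `A` under the partial map `st_Y`. -/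
def stYPreimage (R : Set (Set X)) (P : I → Finpartition (Set.univ : Set X)) (A : Set X) :
    Set (Y U P) :=
  {y | ∃ a ∈ A, IsStY R P y a}

open Classical in
variable (U) in
/-- `f ∘ st_Y`, extended by `0` to the points where `st_Y` is not defined. -/
def compStY (R : Set (Set X)) (P : I → Finpartition (Set.univ : Set X)) (f : X → K)
    (y : Y U P) : K :=
  if h : ∃ a, IsStY R P y a then f h.choose else 0

/-- `*μ` has nearstandard values on the internal sets in `*R`. -/
def HasNearstandardValues (U : Ultrafilter I) (R : Set (Set X)) (μ : Set X → K) : Prop :=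
  ∀ B : Germ (U : Filter I) (Set X), B.LiftPred (· ∈ R) → IsNearstandard (B.map μ)

/-- `(X, R_μ, μ)` is the push-down, via `st_Y`, of the Loeb space of the hyperfinite space `Y` of
the partition `P` of `*X` into classes in `*R`. -/
structure IsPushDown (U : Ultrafilter I) (R : Set (Set X)) (μ : Set X → K)
    (P : I → Finpartition (Set.univ : Set X)) : Prop where
  classes_mem : ∀ i, ∀ C ∈ (P i).parts, C ∈ R
  ae_defined : IsLoebNull (U := U) (quotMeasure μ P) {y | ¬ ∃ a, IsStY R P y a}
  measurable_iff : ∀ A : Set X,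
    A ∈ extended R μ ↔ stYPreimage U R P A ∈ loebSets U (quotMeasure μ P)
  measure_eq : ∀ A ∈ extended R μ, ∀ c : K, IsExtendedValue R μ A c →
    loebMeasure U (quotMeasure μ P) (stYPreimage U R P A) = c

end Quotient

end Nonstandard

end NonArch

end

open NonArch

namespace NonArch

/-! ### Standard measures: the integral is controlled by the norm function -/

section Standard

variable {X K : Type*} [NontriviallyNormedField K]

/-! Everything rests on the estimate |m(A)| ≤ sup of `N_m` over `A` (`IsNormControlled`). For μ it
comes from continuity (`IsMeasure.isNormControlled`); for the Loeb measure it comes from the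
ultrametric inequality for hyperfinite sums (`IsHyperfiniteMeasure.isNormControlled`). It makes the
integral of simple functions 1-Lipschitz for the seminorm, so integrals of integrable functions are
limits of those of approximating simple functions.

For f ∘ st_Y: the push-down hypothesis turns a simple g into a Loeb-simple g ∘ st_Y with the same
integral, and `N` of the Loeb measure at y is at most `N_μ` at st_Y(y) (`normFun_loeb_le`). Hence
composition with st_Y does not increase the seminorm, and approximating sequences and integrals
carry over.

For the lifting: the same estimate yields in each class C a point p(C) with |μ(C)| ≤ 2 `N_μ`(p(C))
(`exists_representatives`). Put F = *f ∘ p. Then |F(y) - *g(p(y))| |ν({y})| ≤ 2 ‖f - g‖ for every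
simple g (`enorm_sub_mul_le`), and because sums are ultrametric the same bound holds for the
hyperfinite integral. So S-integrability, the standard part of F and the value of its integral all
reduce to simple functions, for which they follow from boundedness, from the clopenness of members
of the algebra, and from the push-down hypothesis. -/

theorem enorm_le_setNorm {R : Set (Set X)} {μ : Set X → K} {A B : Set X} (hB : B ∈ R)
    (h : B ⊆ A) : ‖μ B‖ₑ ≤ setNorm R μ A :=
  le_iSup₂_of_le (f := fun B (_ : B ∈ {B : Set X | B ∈ R ∧ B ⊆ A}) => ‖μ B‖ₑ) B ⟨hB, h⟩ le_rfl

theorem setNorm_le {R : Set (Set X)} {μ : Set X → K} {A : Set X} {c : ℝ≥0∞}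
    (h : ∀ B ∈ R, B ⊆ A → ‖μ B‖ₑ ≤ c) : setNorm R μ A ≤ c :=
  iSup₂_le fun B hB => h B hB.1 hB.2

theorem normFun_le {R : Set (Set X)} {μ : Set X → K} {A : Set X} {x : X} (hA : A ∈ R)
    (h : x ∈ A) : normFun R μ x ≤ setNorm R μ A :=
  iInf₂_le (f := fun A (_ : A ∈ {A : Set X | A ∈ R ∧ x ∈ A}) => setNorm R μ A) A ⟨hA, h⟩

theorem le_normFun {R : Set (Set X)} {μ : Set X → K} {x : X} {c : ℝ≥0∞}
    (h : ∀ A ∈ R, x ∈ A → c ≤ setNorm R μ A) : c ≤ normFun R μ x :=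
  le_iInf₂ fun A hA => h A hA.1 hA.2

theorem exists_setNorm_lt {R : Set (Set X)} {μ : Set X → K} {x : X} {c : ℝ≥0∞}
    (h : normFun R μ x < c) : ∃ A ∈ R, x ∈ A ∧ setNorm R μ A < c := by
  simp only [normFun, iInf_lt_iff] at h
  obtain ⟨A, hA, hc⟩ := h
  exact ⟨A, hA.1, hA.2, hc⟩

theorem le_funNorm (R : Set (Set X)) (μ : Set X → K) (f : X → K) (x : X) :
    ‖f x‖ₑ * normFun R μ x ≤ funNorm R μ f :=
  le_iSup (fun x => ‖f x‖ₑ * normFun R μ x) x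

/-- Points with `N = 0` contribute nothing to the supremum. In the Loeb space these points form the
Loeb null sets, so this gives the invariance under almost everywhere equality. -/
theorem funNorm_congr {R : Set (Set X)} {μ : Set X → K} {f g : X → K}
    (h : ∀ x, normFun R μ x ≠ 0 → f x = g x) : funNorm R μ f = funNorm R μ g := by
  refine iSup_congr fun x => ?_
  by_cases hx : normFun R μ x = 0
  · simp [hx]
  · rw [h x hx]

theorem approximates_congr {R : Set (Set X)} {μ : Set X → K} {f g : X → K}
    (h : ∀ x, normFun R μ x ≠ 0 → f x = g x) (s : ℕ → SimpleFun R K) :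
    Approximates R μ s f ↔ Approximates R μ s g := by
  unfold Approximates
  simp_rw [fun n => funNorm_congr (R := R) (μ := μ) (f := fun x => f x - (s n).toFun x)
    (g := fun x => g x - (s n).toFun x) fun x hx => by rw [h x hx]]

theorem isIntegrable_congr {R : Set (Set X)} {μ : Set X → K} {f g : X → K}
    (h : ∀ x, normFun R μ x ≠ 0 → f x = g x) : IsIntegrable R μ f ↔ IsIntegrable R μ g :=
  exists_congr (approximates_congr h)

theorem integral_congr {R : Set (Set X)} {μ : Set X → K} {f g : X → K}
    (h : ∀ x, normFun R μ x ≠ 0 → f x = g x) : integral R μ f = integral R μ g := by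
  -- The integral sees the function only through its approximating sequences, and this includes the
  -- default value 0.
  have : (fun s => Approximates R μ s f) = fun s => Approximates R μ s g :=
    funext fun s => propext (approximates_congr h s)
  classical
  exact congrArg (fun Q : (ℕ → SimpleFun R K) → Prop => if h : ∃ c : K, ∀ s, Q s →
    Tendsto (fun n => (s n).integral μ) atTop (𝓝 c) then h.choose else 0) this

/-- If `{x}` belongs to `R`, the norm function at `x` is the norm of the measure of `{x}`. -/
theorem normFun_eq_of_singleton_mem {R : Set (Set X)} {μ : Set X → K} {x : X} (hx : {x} ∈ R)
    (h0 : μ ∅ = 0) : normFun R μ x = ‖μ {x}‖ₑ := by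
  refine le_antisymm ((normFun_le hx rfl).trans (setNorm_le fun B _ hB => ?_))
    (le_normFun fun A _ hxA => enorm_le_setNorm hx (Set.singleton_subset_iff.2 hxA))
  rcases Set.subset_singleton_iff_eq.1 hB with rfl | rfl <;> simp [h0]

theorem measure_empty_of_additive {R : Set (Set X)} {μ : Set X → K} (he : ∅ ∈ R)
    (h : ∀ A ∈ R, ∀ B ∈ R, Disjoint A B → μ (A ∪ B) = μ A + μ B) : μ ∅ = 0 := by
  simpa using h ∅ he ∅ he (by simp)

theorem enorm_add_le_max' [IsUltrametricDist K] (a b : K) : ‖a + b‖ₑ ≤ max ‖a‖ₑ ‖b‖ₑ := by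
  have := IsUltrametricDist.nnnorm_add_le_max a b
  simp only [enorm_eq_nnnorm]
  exact_mod_cast this

theorem enorm_sum_le_of_forall_le [IsUltrametricDist K] {ι : Type*} (s : Finset ι) (f : ι → K)
    (c : ℝ≥0∞) (h : ∀ i ∈ s, ‖f i‖ₑ ≤ c) : ‖∑ i ∈ s, f i‖ₑ ≤ c := by
  classical
  induction s using Finset.induction_on with
  | empty => simp
  | insert a s ha ih =>
    rw [Finset.sum_insert ha]
    exact (enorm_add_le_max' _ _).trans (max_le (h a (by simp))
      (ih fun i hi => h i (Finset.mem_insert_of_mem hi)))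

theorem enorm_sub_le_max [IsUltrametricDist K] (a b : K) : ‖a - b‖ₑ ≤ max ‖a‖ₑ ‖b‖ₑ := by
  simpa [sub_eq_add_neg] using enorm_add_le_max' a (-b)

/-- Additive set functions on an algebra that are bounded by their norm functions. -/
structure IsNormControlled (R : Set (Set X)) (μ : Set X → K) : Prop where
  algebra : MeasureTheory.IsSetAlgebra R
  additive : ∀ A ∈ R, ∀ B ∈ R, Disjoint A B → μ (A ∪ B) = μ A + μ B
  enorm_le : ∀ A ∈ R, ‖μ A‖ₑ ≤ ⨆ x ∈ A, normFun R μ x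

/-- Each new set `A k` cuts `B` in two: on `B ∩ A k` the constant becomes `c + a k`, on `B \ A k` it
stays `c`. Letting `c` and `B` vary makes the induction close without a disjoint presentation of the
simple function. -/
theorem IsNormControlled.enorm_sum_inter_le [IsUltrametricDist K] {R : Set (Set X)}
    {μ : Set X → K} (h : IsNormControlled R μ) {ι : Type*} (s : Finset ι) (a : ι → K)
    (A : ι → Set X) (hA : ∀ j ∈ s, A j ∈ R) (c : K) (B : Set X) (hB : B ∈ R) :
    ‖c * μ B + ∑ j ∈ s, a j * μ (A j ∩ B)‖ₑ ≤
      ⨆ x ∈ B, ‖c + ∑ j ∈ s, (A j).indicator (fun _ => a j) x‖ₑ * normFun R μ x := by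
  classical
  induction s using Finset.induction_on generalizing c B with
  | empty =>
    simp only [Finset.sum_empty, add_zero, enorm_mul]
    simp_rw [← ENNReal.mul_iSup]
    exact mul_le_mul_right (h.enorm_le B hB) _
  | insert k s hk ih =>
    have hAk := hA k (by simp)
    have hAs : ∀ j ∈ s, A j ∈ R := fun j hj => hA j (by simp [hj])
    have hsplit : ∀ C ∈ R, μ C = μ (C ∩ A k) + μ (C \ A k) := fun C hC => by
      conv_lhs => rw [← Set.inter_union_sdiff C (A k)]
      exact h.additive _ (h.algebra.inter_mem hC hAk) _ (h.algebra.sdiff_mem hC hAk)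
        Set.disjoint_sdiff_inter.symm
    have h1 := ih hAs (c + a k) (B ∩ A k) (h.algebra.inter_mem hB hAk)
    have h2 := ih hAs c (B \ A k) (h.algebra.sdiff_mem hB hAk)
    have e : c * μ B + ∑ j ∈ insert k s, a j * μ (A j ∩ B) =
        ((c + a k) * μ (B ∩ A k) + ∑ j ∈ s, a j * μ (A j ∩ (B ∩ A k))) +
        (c * μ (B \ A k) + ∑ j ∈ s, a j * μ (A j ∩ (B \ A k))) := by
      have : ∀ j ∈ s, a j * μ (A j ∩ B) =
          a j * μ (A j ∩ (B ∩ A k)) + a j * μ (A j ∩ (B \ A k)) := fun j hj => by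
        rw [hsplit _ (h.algebra.inter_mem (hAs j hj) hB), Set.inter_assoc, Set.inter_sdiff_assoc,
          mul_add]
      rw [Finset.sum_insert hk, Finset.sum_congr rfl this, Finset.sum_add_distrib, hsplit B hB,
        Set.inter_comm (A k) B]
      ring
    rw [e]
    refine (enorm_add_le_max' _ _).trans (max_le (h1.trans ?_) (h2.trans ?_))
    · refine iSup₂_le fun x hx => le_iSup₂_of_le x hx.1 ?_
      rw [Finset.sum_insert hk, Set.indicator_of_mem hx.2, add_assoc]
    · refine iSup₂_le fun x hx => le_iSup₂_of_le x hx.1 ?_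
      rw [Finset.sum_insert hk, Set.indicator_of_notMem hx.2, zero_add]

/-- Concatenating the presentations of `g` and `-g'` reduces this to the previous lemma. In
particular the integral does not depend on the presentation. -/
theorem IsNormControlled.enorm_integral_sub_le [IsUltrametricDist K] {R : Set (Set X)}
    {μ : Set X → K} (h : IsNormControlled R μ) (g g' : SimpleFun R K) :
    ‖g.integral μ - g'.integral μ‖ₑ ≤ funNorm R μ (fun x => g.toFun x - g'.toFun x) := by
  have key := h.enorm_sum_inter_le Finset.univ
    (Sum.elim g.coef fun j => -g'.coef j) (Sum.elim g.sets g'.sets)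
    (by rintro (j | j) _; exacts [g.mem j, g'.mem j]) 0 Set.univ h.algebra.univ_mem
  simp only [Fintype.sum_sum_type, Sum.elim_inl, Sum.elim_inr, zero_mul, zero_add,
    Set.inter_univ, Set.mem_univ, iSup_pos, neg_mul, Finset.sum_neg_distrib] at key
  rw [SimpleFun.integral, SimpleFun.integral, sub_eq_add_neg]
  refine key.trans (le_of_eq (iSup_congr fun x => ?_))
  simp only [SimpleFun.toFun]
  rw [sub_eq_add_neg, ← Finset.sum_neg_distrib]
  congr! 4 with j
  by_cases hx : x ∈ g'.sets j <;> simp [hx]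

theorem funNorm_sub_le [IsUltrametricDist K] (R : Set (Set X)) (μ : Set X → K) (f g k : X → K) :
    funNorm R μ (fun x => g x - k x) ≤
      max (funNorm R μ fun x => f x - g x) (funNorm R μ fun x => f x - k x) := by
  refine iSup_le fun x => ?_
  have : g x - k x = (f x - k x) - (f x - g x) := by ring
  simp only [this]
  refine (mul_le_mul_left (enorm_sub_le_max _ _) _).trans ?_
  rw [max_mul]
  exact max_le ((le_funNorm R μ (fun x => f x - k x) x).trans (le_max_right _ _))
    ((le_funNorm R μ (fun x => f x - g x) x).trans (le_max_left _ _))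

theorem IsNormControlled.enorm_integral_sub_le_max [IsUltrametricDist K] {R : Set (Set X)}
    {μ : Set X → K} (h : IsNormControlled R μ) (f : X → K) (g g' : SimpleFun R K) :
    ‖g.integral μ - g'.integral μ‖ₑ ≤
      max (funNorm R μ fun x => f x - g.toFun x) (funNorm R μ fun x => f x - g'.toFun x) :=
  (h.enorm_integral_sub_le g g').trans (funNorm_sub_le R μ f _ _)

theorem tendsto_of_enorm_sub_le {α : Type*} {l : Filter α} {u v : α → K} {c : K}
    {r : α → ℝ≥0∞} (hv : Tendsto v l (𝓝 c)) (hr : Tendsto r l (𝓝 0))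
    (h : ∀ a, ‖u a - v a‖ₑ ≤ r a) : Tendsto u l (𝓝 c) := by
  have : Tendsto (fun a => u a - v a) l (𝓝 0) :=
    tendsto_zero_iff_enorm_tendsto_zero.2 (tendsto_of_tendsto_of_tendsto_of_le_of_le
      tendsto_const_nhds hr (fun _ => zero_le) h)
  simpa using this.add hv

/-- The integral of an integrable function is the limit of the integrals of approximating simple
functions. -/
theorem IsNormControlled.tendsto_integral [IsUltrametricDist K] [CompleteSpace K]
    {R : Set (Set X)} {μ : Set X → K} (h : IsNormControlled R μ) {f : X → K}
    {g : ℕ → SimpleFun R K} (hg : Approximates R μ g f) :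
    Tendsto (fun n => (g n).integral μ) atTop (𝓝 (integral R μ f)) := by
  have hc : CauchySeq fun n => (g n).integral μ := by
    rw [EMetric.cauchySeq_iff]
    intro ε hε
    obtain ⟨N, hN⟩ := eventually_atTop.1 (hg.eventually_lt_const hε)
    refine ⟨N, fun m hm n hn => ?_⟩
    rw [edist_eq_enorm_sub]
    exact (h.enorm_integral_sub_le_max f _ _).trans_lt (max_lt (hN m hm) (hN n hn))
  obtain ⟨c, hgc⟩ := cauchySeq_tendsto_of_complete hc
  have hex : ∃ c : K, ∀ g : ℕ → SimpleFun R K, Approximates R μ g f →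
      Tendsto (fun n => (g n).integral μ) atTop (𝓝 c) := by
    refine ⟨c, fun g' hg' => tendsto_of_enorm_sub_le hgc ?_
      fun n => h.enorm_integral_sub_le_max f (g' n) (g n)⟩
    simpa using Tendsto.max hg' hg
  rw [integral, dif_pos hex]
  exact hex.choose_spec g hg

theorem setNorm_union_le [IsUltrametricDist K] {R : Set (Set X)} {μ : Set X → K}
    (hR : MeasureTheory.IsSetAlgebra R)
    (h : ∀ A ∈ R, ∀ B ∈ R, Disjoint A B → μ (A ∪ B) = μ A + μ B) {A B : Set X} (hA : A ∈ R) :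
    setNorm R μ (A ∪ B) ≤ max (setNorm R μ A) (setNorm R μ B) := by
  refine setNorm_le fun C hC hCAB => ?_
  rw [← Set.inter_union_sdiff C A, h _ (hR.inter_mem hC hA) _ (hR.sdiff_mem hC hA)
    Set.disjoint_sdiff_inter.symm]
  refine (enorm_add_le_max' _ _).trans (max_le_max
    (enorm_le_setNorm (hR.inter_mem hC hA) Set.inter_subset_right)
    (enorm_le_setNorm (hR.sdiff_mem hC hA) ?_))
  rintro x ⟨hxC, hxA⟩
  exact (hCAB hxC).resolve_left hxA

/-- A measure is bounded on a set by the supremum of its norm function. -/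
theorem IsMeasure.isNormControlled [IsUltrametricDist K] {R : Set (Set X)} {μ : Set X → K}
    (hμ : IsMeasure R μ) (hR : MeasureTheory.IsSetAlgebra R) : IsNormControlled R μ := by
  refine ⟨hR, hμ.additive, fun A hA => le_of_forall_gt_imp_ge_of_dense fun c hc => ?_⟩
  rcases eq_or_ne c ⊤ with rfl | hctop
  · exact le_top
  have h0 : μ ∅ = 0 := measure_empty_of_additive hR.empty_mem hμ.additive
  have hempty : setNorm R μ ∅ ≤ c := setNorm_le fun B _ hB => by
    simp [Set.subset_empty_iff.1 hB, h0]
  have hcpos : 0 < c.toReal := ENNReal.toReal_pos (zero_le.trans_lt hc).ne' hctop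
  -- The sets `A \ B` with `‖B‖ ≤ c` are closed under intersection, and their intersection is empty
  -- because `N < c` on `A`. Continuity yields one with `|μ(A \ B)| < c`, while `|μ(A ∩ B)| ≤ ‖B‖ ≤
  -- c`.
  obtain ⟨_, ⟨B, hB, hBc, rfl⟩, hlt⟩ := hμ.continuous
    {C | ∃ B ∈ R, setNorm R μ B ≤ c ∧ A \ B = C}
    (by rintro _ ⟨B, hB, -, rfl⟩; exact hR.sdiff_mem hA hB)
    ⟨A \ ∅, ∅, hR.empty_mem, hempty, rfl⟩
    (by
      rintro _ ⟨B, hB, hBc, rfl⟩ _ ⟨B', hB', hBc', rfl⟩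
      exact ⟨B ∪ B', hR.union_mem hB hB', (setNorm_union_le hR hμ.additive hB).trans
        (max_le hBc hBc'), Set.sdiff_inter_sdiff.symm⟩)
    (by
      refine Set.eq_empty_of_forall_notMem fun x hx => ?_
      have hxA : x ∈ A := (hx (A \ ∅) ⟨∅, hR.empty_mem, hempty, rfl⟩).1
      obtain ⟨B, hB, hxB, hBc⟩ := exists_setNorm_lt
        ((le_iSup₂ (f := fun x (_ : x ∈ A) => normFun R μ x) x hxA).trans_lt hc)
      exact (hx (A \ B) ⟨B, hB, hBc.le, rfl⟩).2 hxB)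
    c.toReal hcpos
  rw [← Set.inter_union_sdiff A B, hμ.additive _ (hR.inter_mem hA hB) _ (hR.sdiff_mem hA hB)
    Set.disjoint_sdiff_inter.symm]
  refine (enorm_add_le_max' _ _).trans (max_le
    ((enorm_le_setNorm (hR.inter_mem hA hB) Set.inter_subset_right).trans hBc) ?_)
  rw [← ofReal_norm, ← ENNReal.ofReal_toReal hctop]
  exact ENNReal.ofReal_le_ofReal hlt.le

end Standard

/-! ### Transfer along the ultrafilter -/

section Nonstandard

variable {I : Type*} {U : Ultrafilter I}

theorem coe_mem_monad_iff {T : Type*} [t : TopologicalSpace T] {g : I → T} {a : T} :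
    (g : Germ (U : Filter I) T) ∈ monad t a ↔ Tendsto g U (𝓝 a) := by
  rw [tendsto_nhds]
  rfl

theorem infinitesimal_coe_iff {r : I → ℝ≥0∞} :
    Infinitesimal (r : Germ (U : Filter I) ℝ≥0∞) ↔ Tendsto r U (𝓝 0) := by
  rw [ENNReal.tendsto_nhds_zero]
  refine ⟨fun h ε hε => ?_, fun h ε hε => h ε (by exact_mod_cast hε)⟩
  rcases eq_or_ne ε ⊤ with rfl | htop
  · exact Eventually.of_forall fun _ => le_top
  · lift ε to ℝ≥0 using htop
    exact h ε (by exact_mod_cast hε)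

theorem stK_coe {K : Type*} [NontriviallyNormedField K] {g : I → K} {a : K}
    (h : Tendsto g U (𝓝 a)) : stK (g : Germ (U : Filter I) K) = a := by
  have hex : ∃ a : K, (g : Germ (U : Filter I) K) ∈ monad inferInstance a :=
    ⟨a, coe_mem_monad_iff.2 h⟩
  rw [stK, dif_pos hex]
  exact tendsto_nhds_unique (coe_mem_monad_iff.1 hex.choose_spec) h

/-- The existential case of Łoś's theorem. The hypothesis `hne` supplies arbitrary values at the
exceptional indices. -/
theorem exists_forall_eventually {Ω : I → Type*} (hne : (∃ i, Nonempty (Ω i)) → ∀ i, Nonempty (Ω i))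
    {p : ∀ i, Ω i → Prop} (h : ∀ᶠ i in U, ∃ y, p i y) :
    ∃ y : ∀ i, Ω i, ∀ᶠ i in U, p i (y i) := by
  classical
  have hN := hne (h.exists.imp fun i hi => ⟨hi.choose⟩)
  refine ⟨fun i => if hi : ∃ y, p i y then hi.choose else (hN i).some, h.mono fun i hi => ?_⟩
  simp only [dif_pos hi]
  exact hi.choose_spec

/-- A family of functions to `[0, ∞]` tends to zero uniformly along an ultrafilter if it tends to
zero at all points of the ultraproduct. -/
theorem tendsto_iSup_of_forall_tendsto {Ω : I → Type*}
    (hne : (∃ i, Nonempty (Ω i)) → ∀ i, Nonempty (Ω i)) {r : ∀ i, Ω i → ℝ≥0∞}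
    (h : ∀ y : ∀ i, Ω i, Tendsto (fun i => r i (y i)) U (𝓝 0)) :
    Tendsto (fun i => ⨆ y, r i y) U (𝓝 0) := by
  rw [ENNReal.tendsto_nhds_zero]
  intro ε hε
  by_contra hcon
  rw [← Ultrafilter.eventually_not] at hcon
  obtain ⟨y, hy⟩ := exists_forall_eventually (U := U) hne
    (p := fun i y => ε < r i y) (hcon.mono fun i hi => by
      rw [not_le, lt_iSup_iff] at hi
      exact hi)
  obtain ⟨i, hi, hi'⟩ := (hy.and (ENNReal.tendsto_nhds_zero.1 (h y) ε hε)).exists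
  exact absurd hi hi'.not_gt

/-! ### Loeb measures of hyperfinite spaces -/

section Loeb

variable {K : Type*} [NontriviallyNormedField K] {Ω : I → Type*}

variable (U) in
/-- The element of the ultraproduct represented by a family of elements. -/
def productMk (y : ∀ i, Ω i) : Product (U : Filter I) Ω :=
  (y : Product (U : Filter I) Ω)

theorem product_induction {p : Product (U : Filter I) Ω → Prop}
    (h : ∀ y : ∀ i, Ω i, p (productMk U y)) (y : Product (U : Filter I) Ω) : p y :=
  Quotient.inductionOn' y h

theorem coe_mem_internalSet {B : ∀ i, Set (Ω i)} {y : ∀ i, Ω i} :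
    productMk U y ∈ internalSet U B ↔ ∀ᶠ i in U, y i ∈ B i :=
  Iff.rfl

theorem internalSet_compl (B : ∀ i, Set (Ω i)) :
    internalSet U (fun i => (B i)ᶜ) = (internalSet U B)ᶜ := by
  ext y
  induction y using product_induction with | h y => ?_
  rw [Set.mem_compl_iff, coe_mem_internalSet, coe_mem_internalSet, ← Ultrafilter.eventually_not]
  rfl

theorem internalSet_union (A B : ∀ i, Set (Ω i)) :
    internalSet U (fun i => A i ∪ B i) = internalSet U A ∪ internalSet U B := by
  ext y
  induction y using product_induction with | h y => ?_
  rw [Set.mem_union, coe_mem_internalSet, coe_mem_internalSet, coe_mem_internalSet,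
    ← Ultrafilter.eventually_or]
  rfl

theorem internalSet_diff (A B : ∀ i, Set (Ω i)) :
    internalSet U (fun i => A i \ B i) = internalSet U A \ internalSet U B := by
  ext y
  induction y using product_induction with | h y => ?_
  rw [Set.mem_sdiff, coe_mem_internalSet, coe_mem_internalSet, coe_mem_internalSet,
    ← Ultrafilter.eventually_not, ← eventually_and]
  rfl

theorem internalSet_empty : internalSet U (fun i => (∅ : Set (Ω i))) = ∅ := by
  ext y
  induction y using product_induction with | h y => ?_
  rw [coe_mem_internalSet]
  simp [U.neBot.ne]

theorem internalSet_singleton (y : ∀ i, Ω i) :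
    internalSet U (fun i => {y i}) = {productMk U y} := by
  ext z
  induction z using product_induction with | h z => ?_
  rw [coe_mem_internalSet, Set.mem_singleton_iff]
  exact (Quotient.eq'' (s₁ := productSetoid (U : Filter I) Ω)).symm

theorem isLoebNull_mono {ν : ∀ i, Set (Ω i) → K} {A B : Set (Product (U : Filter I) Ω)} (hB : IsLoebNull ν B) (hAB : A ⊆ B) :
    IsLoebNull ν A := fun y hy => hB y (hAB hy)

theorem isLoebNull_union {ν : ∀ i, Set (Ω i) → K} {A B : Set (Product (U : Filter I) Ω)} (hA : IsLoebNull ν A)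
    (hB : IsLoebNull ν B) : IsLoebNull ν (A ∪ B) := fun y hy => hy.elim (hA y) (hB y)

theorem internalSet_mem_loebSets (ν : ∀ i, Set (Ω i) → K) (B : ∀ i, Set (Ω i)) : internalSet U B ∈ loebSets U ν :=
  ⟨B, by simp [IsLoebNull]⟩

theorem isSetAlgebra_loebSets (ν : ∀ i, Set (Ω i) → K) : MeasureTheory.IsSetAlgebra (loebSets U ν) where
  empty_mem := internalSet_empty (U := U) (Ω := Ω) ▸ internalSet_mem_loebSets ν _
  compl_mem := by
    rintro A ⟨B, hB⟩
    refine ⟨fun i => (B i)ᶜ, ?_⟩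
    rwa [internalSet_compl, compl_symmDiff_compl]
  union_mem := by
    rintro A A' ⟨B, hB⟩ ⟨B', hB'⟩
    refine ⟨fun i => B i ∪ B' i, isLoebNull_mono (isLoebNull_union hB hB') ?_⟩
    rw [internalSet_union]
    exact Set.union_symmDiff_union_subset ..

variable (U) in
/-- Internal hyperfinite `*K`-valued measures with nearstandard values. -/
structure IsHyperfiniteMeasure (ν : ∀ i, Set (Ω i) → K) : Prop where
  finite : ∀ i, Finite (Ω i)
  nonempty : (∃ i, Nonempty (Ω i)) → ∀ i, Nonempty (Ω i)
  additive : ∀ i A B, Disjoint A B → ν i (A ∪ B) = ν i A + ν i B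
  nearstandard : ∀ B : ∀ i, Set (Ω i), ∃ c, Tendsto (fun i => ν i (B i)) U (𝓝 c)

namespace IsHyperfiniteMeasure

variable {ν : ∀ i, Set (Ω i) → K} (h : IsHyperfiniteMeasure U ν)

include h

theorem measure_empty (i : I) : ν i ∅ = 0 := by simpa using h.additive i ∅ ∅ (by simp)

theorem normFun_eq (i : I) (y : Ω i) : normFun Set.univ (ν i) y = ‖ν i {y}‖ₑ :=
  normFun_eq_of_singleton_mem (Set.mem_univ _) (h.measure_empty i)

theorem measure_eq_sum (i : I) (s : Finset (Ω i)) : ν i s = ∑ y ∈ s, ν i {y} := by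
  classical
  induction s using Finset.induction_on with
  | empty => simp [h.measure_empty]
  | insert a s ha ih =>
    rw [Finset.sum_insert ha, ← ih, Finset.coe_insert, Set.insert_eq, h.additive]
    simpa using ha

variable [IsUltrametricDist K]

theorem enorm_measure_le (i : I) (B : Set (Ω i)) : ‖ν i B‖ₑ ≤ ⨆ y : Ω i, ⨆ _ : y ∈ B, ‖ν i {y}‖ₑ := by
  have := h.finite i
  have hB := h.measure_eq_sum i B.toFinite.toFinset
  rw [Set.Finite.coe_toFinset] at hB
  rw [hB]
  refine enorm_sum_le_of_forall_le _ _ _ fun y hy => ?_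
  exact le_iSup₂_of_le (f := fun y (_ : y ∈ B) => ‖ν i {y}‖ₑ) y (by simpa using hy) le_rfl

omit [IsUltrametricDist K] in
theorem infinitesimal_iff (y : ∀ i, Ω i) :
    Infinitesimal (starNormFun ν (productMk U y)) ↔
      Tendsto (fun i => ν i {y i}) U (𝓝 0) := by
  rw [tendsto_zero_iff_enorm_tendsto_zero, ← infinitesimal_coe_iff]
  simp_rw [← h.normFun_eq]
  rfl

/-- The internal measure of `B` is at most the supremum of the point masses in `B`. These are
infinitesimal at every point, hence uniformly so. -/
theorem tendsto_of_isLoebNull {B : ∀ i, Set (Ω i)} (hB : IsLoebNull ν (internalSet U B)) :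
    Tendsto (fun i => ν i (B i)) U (𝓝 0) := by
  rw [tendsto_zero_iff_enorm_tendsto_zero]
  refine tendsto_of_tendsto_of_tendsto_of_le_of_le tendsto_const_nhds
    (tendsto_iSup_of_forall_tendsto (U := U) (r := fun i y => ⨆ _ : y ∈ B i, ‖ν i {y}‖ₑ)
      h.nonempty fun y => ?_)
    (fun _ => zero_le) (fun i => h.enorm_measure_le i (B i))
  by_cases hy : productMk U y ∈ internalSet U B
  · exact tendsto_of_tendsto_of_tendsto_of_le_of_le tendsto_const_nhds
      (tendsto_zero_iff_enorm_tendsto_zero.1 ((h.infinitesimal_iff y).1 (hB _ hy)))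
      (fun _ => zero_le) (fun i => iSup_const_le)
  · rw [coe_mem_internalSet, ← Ultrafilter.eventually_not] at hy
    exact tendsto_const_nhds.congr' (hy.mono fun i hi => by simp [hi])

omit [IsUltrametricDist K] in
theorem measure_sub (i : I) (A B : Set (Ω i)) : ν i A - ν i B = ν i (A \ B) - ν i (B \ A) := by
  have h1 := h.additive i (A ∩ B) (A \ B) Set.disjoint_sdiff_inter.symm
  have h2 := h.additive i (B ∩ A) (B \ A) Set.disjoint_sdiff_inter.symm
  rw [Set.inter_union_sdiff] at h1 h2
  rw [h1, h2, Set.inter_comm]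
  ring

/-- The Loeb measure of `A` is the standard part of the measure of every internal set that
approximates `A`. -/
theorem tendsto_loebMeasure {A : Set (Product (U : Filter I) Ω)} {B : ∀ i, Set (Ω i)}
    (hB : IsLoebNull ν (symmDiff A (internalSet U B))) :
    Tendsto (fun i => ν i (B i)) U (𝓝 (loebMeasure U ν A)) := by
  have hex : ∃ B : ∀ i, Set (Ω i), IsLoebNull ν (symmDiff A (internalSet U B)) := ⟨B, hB⟩
  rw [loebMeasure, dif_pos hex]
  obtain ⟨c, hc⟩ := h.nearstandard hex.choose
  have hB' := hex.choose_spec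
  set B' := hex.choose
  rw [starValue, stK_coe hc]
  -- A point of `C \ D` lies in `A \ D` or in `C \ A`, so the difference of two internal
  -- approximations of `A` is internal and Loeb null.
  have hd : ∀ C D : ∀ i, Set (Ω i), IsLoebNull ν (symmDiff A (internalSet U C)) →
      IsLoebNull ν (symmDiff A (internalSet U D)) →
      Tendsto (fun i => ν i (C i \ D i)) U (𝓝 0) := fun C D hC hD => by
    refine h.tendsto_of_isLoebNull (isLoebNull_mono (isLoebNull_union hC hD) ?_)
    rw [internalSet_diff]
    rintro y ⟨hyC, hyD⟩
    by_cases hyA : y ∈ A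
    · exact Or.inr (Or.inl ⟨hyA, hyD⟩)
    · exact Or.inl (Or.inr ⟨hyC, hyA⟩)
  have := ((hd B B' hB hB').sub (hd B' B hB' hB)).add hc
  simpa [← h.measure_sub] using this

theorem tendsto_loebMeasure_internalSet (B : ∀ i, Set (Ω i)) :
    Tendsto (fun i => ν i (B i)) U (𝓝 (loebMeasure U ν (internalSet U B))) :=
  h.tendsto_loebMeasure (by simp [IsLoebNull])

theorem loebMeasure_empty : loebMeasure U ν ∅ = 0 := by
  have := h.tendsto_loebMeasure_internalSet fun i => ∅
  rw [internalSet_empty] at this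
  simp only [h.measure_empty] at this
  exact (tendsto_nhds_unique tendsto_const_nhds this).symm

theorem normFun_loeb_eq (y : Product (U : Filter I) Ω) :
    normFun (loebSets U ν) (loebMeasure U ν) y = ‖loebMeasure U ν {y}‖ₑ := by
  induction y using product_induction with | h y => ?_
  refine normFun_eq_of_singleton_mem ?_ h.loebMeasure_empty
  rw [← internalSet_singleton]
  exact internalSet_mem_loebSets ν _

/-- The norm function of the Loeb measure is the standard part of the internal norm function. -/
theorem tendsto_normFun_loeb (y : ∀ i, Ω i) :
    Tendsto (fun i => ‖ν i {y i}‖ₑ) U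
      (𝓝 (normFun (loebSets U ν) (loebMeasure U ν) (productMk U y))) := by
  have := h.tendsto_loebMeasure_internalSet fun i => {y i}
  rw [internalSet_singleton] at this
  rw [h.normFun_loeb_eq]
  exact this.enorm

theorem isLoebNull_iff {A : Set (Product (U : Filter I) Ω)} :
    IsLoebNull ν A ↔ ∀ y ∈ A, normFun (loebSets U ν) (loebMeasure U ν) y = 0 := by
  refine forall₂_congr fun y _ => ?_
  induction y using product_induction with | h y => ?_
  rw [h.infinitesimal_iff, tendsto_zero_iff_enorm_tendsto_zero]
  exact ⟨fun h' => tendsto_nhds_unique (h.tendsto_normFun_loeb y) h',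
    fun h' => h' ▸ h.tendsto_normFun_loeb y⟩

/-- The Loeb measure is bounded on a set by the supremum of its norm function. -/
theorem isNormControlled : IsNormControlled (loebSets U ν) (loebMeasure U ν) where
  algebra := isSetAlgebra_loebSets ν
  additive := by
    rintro A ⟨B, hB⟩ A' ⟨B', hB'⟩ hAA'
    -- Internal approximations of disjoint sets may overlap, but only in a null set; cutting `B` out
    -- of `B'` makes them disjoint.
    have hdiff : IsLoebNull ν (symmDiff A' (internalSet U fun i => B' i \ B i)) := by
      refine isLoebNull_mono (isLoebNull_union hB hB') ?_
      rw [internalSet_diff]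
      rintro y (⟨hy, hy'⟩ | ⟨⟨hy, hy'⟩, hy''⟩)
      · by_cases hyB : y ∈ internalSet U B'
        · have hyB : y ∈ internalSet U B := by
            by_contra hcon
            exact hy' ⟨hyB, hcon⟩
          exact Or.inl (Or.inr ⟨hyB, fun hyA => Set.disjoint_left.1 hAA' hyA hy⟩)
        · exact Or.inr (Or.inl ⟨hy, hyB⟩)
      · exact Or.inr (Or.inr ⟨hy, hy''⟩)
    have hunion : IsLoebNull ν (symmDiff (A ∪ A') (internalSet U fun i => B i ∪ (B' i \ B i))) := by
      rw [internalSet_union]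
      exact isLoebNull_mono (isLoebNull_union hB hdiff) (Set.union_symmDiff_union_subset ..)
    refine tendsto_nhds_unique (h.tendsto_loebMeasure hunion) ?_
    refine ((h.tendsto_loebMeasure hB).add (h.tendsto_loebMeasure hdiff)).congr fun i => ?_
    exact (h.additive i _ _ Set.disjoint_sdiff_right).symm
  enorm_le := by
    rintro A ⟨B, hB⟩
    refine le_of_forall_gt_imp_ge_of_dense fun c hc => ?_
    by_contra! hcon
    have hev := (h.tendsto_loebMeasure hB).enorm.eventually_const_lt hcon
    -- If `|ν_L(A)| > c`, some point of the internal `B` has mass above `c`, so its Loeb norm is at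
    -- least `c > 0`. It cannot lie outside `A`, where `B` is null, nor inside `A`, by the choice of
    -- `c`.
    obtain ⟨y, hy⟩ := exists_forall_eventually (U := U) h.nonempty
      (p := fun i y => y ∈ B i ∧ c < ‖ν i {y}‖ₑ) (hev.mono fun i hi => by
        have := hi.trans_le (h.enorm_measure_le i (B i))
        simp only [lt_iSup_iff] at this
        obtain ⟨y, hy, hy'⟩ := this
        exact ⟨y, hy, hy'⟩)
    have hcN := ge_of_tendsto (h.tendsto_normFun_loeb y) (hy.mono fun i hi => hi.2.le)
    by_cases hyA : productMk U y ∈ A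
    · exact hc.not_ge (hcN.trans (le_iSup₂
        (f := fun y (_ : y ∈ A) => normFun (loebSets U ν) (loebMeasure U ν) y) _ hyA))
    · have := h.isLoebNull_iff.1 hB (productMk U y) (Or.inr ⟨coe_mem_internalSet.2 (hy.mono fun i hi => hi.1), hyA⟩)
      rw [this] at hcN
      exact hc.not_ge (hcN.trans zero_le)

end IsHyperfiniteMeasure

end Loeb

end Nonstandard

/-! ### The space of partition classes and its standard-part map -/

section Quotient

variable {I X K : Type*} [NontriviallyNormedField K] {U : Ultrafilter I} {R : Set (Set X)}
  {μ : Set X → K} {P : I → Finpartition (Set.univ : Set X)}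

theorem Cls.nonempty {i : I} (C : Cls P i) : (C : Set X).Nonempty :=
  Set.nonempty_iff_ne_empty.2 ((P i).ne_bot C.2)

omit [NontriviallyNormedField K] in
theorem quotMeasure_singleton (i : I) (C : Cls P i) : quotMeasure μ P i {C} = μ C := by
  simp [quotMeasure]

theorem biUnion_cls_mem (hR : MeasureTheory.IsSetAlgebra R) {i : I}
    (hP : ∀ C ∈ (P i).parts, C ∈ R) (B : Set (Cls P i)) : ⋃ C ∈ B, (C : Set X) ∈ R := by
  have := hR.biUnion_mem (s := fun C : Cls P i => (C : Set X)) B.toFinite.toFinset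
    fun C _ => hP C C.2
  simpa using this

theorem isHyperfiniteMeasure_quotMeasure (hR : MeasureTheory.IsSetAlgebra R)
    (hμ : ∀ A ∈ R, ∀ B ∈ R, Disjoint A B → μ (A ∪ B) = μ A + μ B)
    (hns : HasNearstandardValues U R μ) (hP : ∀ i, ∀ C ∈ (P i).parts, C ∈ R) :
    IsHyperfiniteMeasure U (quotMeasure μ P) where
  finite i := inferInstance
  nonempty := by
    -- One class already provides a point of `X`, which lies in some class of every other partition.
    rintro ⟨i, ⟨C⟩⟩ j
    obtain ⟨x, -⟩ := C.nonempty
    have hx : x ∈ (P j).parts.sup id := by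
      rw [(P j).sup_parts]
      exact Set.mem_univ x
    rw [Finset.sup_set_eq_biUnion] at hx
    obtain ⟨D, hD, -⟩ := Set.mem_iUnion₂.1 hx
    exact ⟨⟨D, hD⟩⟩
  additive i A B hAB := by
    rw [quotMeasure, Set.biUnion_union]
    refine hμ _ (biUnion_cls_mem hR (hP i) A) _ (biUnion_cls_mem hR (hP i) B) ?_
    simp only [Set.disjoint_iUnion_left, Set.disjoint_iUnion_right]
    intro C hC D hD
    refine (P i).disjoint D.2 C.2 fun h => ?_
    exact Set.disjoint_left.1 hAB hD ((Subtype.ext h : D = C) ▸ hC)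
  nearstandard B := by
    have hB : ((fun i => ⋃ C ∈ B i, (C : Set X) : I → Set X) :
        Germ (U : Filter I) (Set X)).LiftPred (· ∈ R) :=
      Eventually.of_forall fun i => biUnion_cls_mem hR (hP i) (B i)
    obtain ⟨c, hc⟩ := hns _ hB
    exact ⟨c, coe_mem_monad_iff.1 hc⟩

theorem coe_mem_classSet {y : ∀ i, Cls P i} {z : I → X} :
    (z : Germ (U : Filter I) X) ∈ classSet P (productMk U y) ↔
      ∀ᶠ i in U, z i ∈ (y i : Set X) :=
  Iff.rfl

/-- Otherwise points of `y i \ A` could be chosen for almost all `i`; they represent an element of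
the class that is outside the monad of `a`. Applied also to complements, this expresses that members
of the algebra are clopen. -/
theorem eventually_subset_of_isStY {y : ∀ i, Cls P i} {a : X} {A : Set X}
    (h : IsStY R P (productMk U y) a) (hA : A ∈ R) (ha : a ∈ A) :
    ∀ᶠ i in U, (y i : Set X) ⊆ A := by
  by_contra hcon
  rw [← Ultrafilter.eventually_not] at hcon
  obtain ⟨z, hz⟩ := exists_forall_eventually (U := U) (Ω := fun _ => X)
    (fun ⟨_, h⟩ _ => h) (p := fun i x => x ∈ (y i : Set X) ∧ x ∉ A)
    (hcon.mono fun i hi => Set.not_subset.1 hi)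
  have hz' : ∀ᶠ i in U, z i ∈ A := h (coe_mem_classSet.2 (hz.mono fun i hi => hi.1)) A
    (TopologicalSpace.isOpen_generateFrom_of_mem hA) ha
  obtain ⟨i, hi, hi'⟩ := (hz.and hz').exists
  exact hi.2 hi'

theorem isStY_unique (hsep : IsSeparating R) (hR : MeasureTheory.IsSetAlgebra R) {y : Y U P}
    {a b : X} (ha : IsStY R P y a) (hb : IsStY R P y b) : a = b := by
  by_contra hab
  obtain ⟨A, hA, haA, hbA⟩ := hsep a b hab
  induction y using product_induction with | h y => ?_
  obtain ⟨i, hi, hi'⟩ := ((eventually_subset_of_isStY ha hA haA).and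
    (eventually_subset_of_isStY hb (hR.compl_mem hA) hbA)).exists
  obtain ⟨x, hx⟩ := (y i).nonempty
  exact hi' hx (hi hx)

theorem compStY_eq (hsep : IsSeparating R) (hR : MeasureTheory.IsSetAlgebra R) (f : X → K)
    {y : Y U P} {a : X} (ha : IsStY R P y a) : compStY U R P f y = f a := by
  have hex : ∃ a, IsStY R P y a := ⟨a, ha⟩
  rw [compStY, dif_pos hex, isStY_unique hsep hR hex.choose_spec ha]

theorem compStY_of_not_exists (f : X → K) {y : Y U P} (h : ¬ ∃ a, IsStY R P y a) :
    compStY U R P f y = 0 :=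
  dif_neg h

/-- The norm function attains at least half the norm of the measure of every class. -/
theorem exists_representatives (hμ : IsNormControlled R μ) (hP : ∀ i, ∀ C ∈ (P i).parts, C ∈ R) :
    ∃ p : ∀ i, Cls P i → X, ∀ i (C : Cls P i), p i C ∈ (C : Set X) ∧
      ‖μ (C : Set X)‖ₑ ≤ 2 * normFun R μ (p i C) := by
  suffices ∀ i (C : Cls P i), ∃ x ∈ (C : Set X), ‖μ (C : Set X)‖ₑ ≤ 2 * normFun R μ x by
    choose p hp using this
    exact ⟨p, hp⟩
  intro i C
  by_cases h0 : μ (C : Set X) = 0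
  · obtain ⟨x, hx⟩ := C.nonempty
    exact ⟨x, hx, by simp [h0]⟩
  -- The supremum of `N` over `C` need not be attained, hence the factor 2.
  · have hlt : ‖μ (C : Set X)‖ₑ / 2 < ‖μ (C : Set X)‖ₑ :=
      ENNReal.half_lt_self (by simpa using h0) (by simp)
    have := hlt.trans_le (hμ.enorm_le C (hP i C C.2))
    simp only [lt_iSup_iff] at this
    obtain ⟨x, hx, hlt⟩ := this
    refine ⟨x, hx, ?_⟩
    rw [mul_comm]
    exact (ENNReal.div_le_iff_le_mul (by simp) (by simp)).1 hlt.le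

theorem isExtendedValue_self {A : Set X} (hA : A ∈ R) : IsExtendedValue R μ A (μ A) :=
  fun ε _ => ⟨A, hA, by simp, by simp⟩

theorem mem_extended_self {A : Set X} (hA : A ∈ R) : A ∈ extended R μ :=
  fun ε _ => ⟨A, hA, by simp⟩

theorem SimpleFun.exists_enorm_toFun_le [IsUltrametricDist K] (g : SimpleFun R K) :
    ∃ M : ℝ≥0, ∀ x, ‖g.toFun x‖ₑ ≤ M := by
  refine ⟨∑ j, ‖g.coef j‖₊, fun x => enorm_sum_le_of_forall_le _ _ _ fun j _ => ?_⟩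
  refine (enorm_indicator_le_enorm_self (fun _ => g.coef j) x).trans ?_
  rw [enorm_eq_nnnorm]
  exact_mod_cast Finset.single_le_sum (f := fun j => ‖g.coef j‖₊) (fun _ _ => zero_le)
    (Finset.mem_univ j)

theorem SimpleFun.toFun_congr (g : SimpleFun R K) {x y : X}
    (h : ∀ j, x ∈ g.sets j ↔ y ∈ g.sets j) : g.toFun x = g.toFun y := by
  refine Finset.sum_congr rfl fun j _ => ?_
  by_cases hx : x ∈ g.sets j
  · rw [Set.indicator_of_mem hx, Set.indicator_of_mem ((h j).1 hx)]
  · rw [Set.indicator_of_notMem hx, Set.indicator_of_notMem fun hy => hx ((h j).2 hy)]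

/-! ### Integrating f ∘ st_Y -/

namespace IsPushDown

variable (hP : IsPushDown U R μ P)

include hP

/-- The Loeb-simple function `g ∘ st_Y`. -/
def compSimple (g : SimpleFun R K) : SimpleFun (loebSets U (quotMeasure μ P)) K where
  n := g.n
  coef := g.coef
  sets j := stYPreimage U R P (g.sets j)
  mem j := (hP.measurable_iff _).1 (mem_extended_self (g.mem j))

theorem loebMeasure_stYPreimage {A : Set X} (hA : A ∈ R) :
    loebMeasure U (quotMeasure μ P) (stYPreimage U R P A) = μ A :=
  hP.measure_eq A (mem_extended_self hA) _ (isExtendedValue_self hA)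

theorem integral_compSimple (g : SimpleFun R K) :
    (hP.compSimple g).integral (loebMeasure U (quotMeasure μ P)) = g.integral μ :=
  Finset.sum_congr rfl fun j _ => congrArg (g.coef j * ·) (hP.loebMeasure_stYPreimage (g.mem j))

theorem toFun_compSimple (hsep : IsSeparating R) (hR : MeasureTheory.IsSetAlgebra R)
    (g : SimpleFun R K) {y : Y U P} {a : X} (ha : IsStY R P y a) :
    (hP.compSimple g).toFun y = g.toFun a := by
  have hmem : ∀ A, y ∈ stYPreimage U R P A ↔ a ∈ A := fun A =>
    ⟨fun ⟨b, hb, hyb⟩ => isStY_unique hsep hR hyb ha ▸ hb, fun h => ⟨a, h, ha⟩⟩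
  change ∑ j, (stYPreimage U R P (g.sets j)).indicator (fun _ => g.coef j) y = g.toFun a
  refine Finset.sum_congr rfl fun j _ => ?_
  by_cases h : a ∈ g.sets j
  · rw [Set.indicator_of_mem h, Set.indicator_of_mem ((hmem _).2 h)]
  · rw [Set.indicator_of_notMem h, Set.indicator_of_notMem fun h' => h ((hmem _).1 h')]

theorem toFun_compSimple_of_not_exists (g : SimpleFun R K) {y : Y U P}
    (h : ¬ ∃ a, IsStY R P y a) : (hP.compSimple g).toFun y = 0 :=
  Finset.sum_eq_zero fun j _ => Set.indicator_of_notMem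
    (s := stYPreimage U R P (g.sets j)) (fun ⟨a, _, ha⟩ => h ⟨a, ha⟩) _

variable (hR : MeasureTheory.IsSetAlgebra R) (hsep : IsSeparating R) (hμ : IsMeasure R μ)
  (hns : HasNearstandardValues U R μ)

include hR hμ hns

theorem isHyperfiniteMeasure : IsHyperfiniteMeasure U (quotMeasure μ P) :=
  isHyperfiniteMeasure_quotMeasure hR hμ.additive hns hP.classes_mem

variable [IsUltrametricDist K]

/-- Each member `A` of the algebra that contains `a` eventually contains the classes `y i`, so their
masses are at most `‖A‖`. Pass to the limit and take the infimum over `A`. -/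
theorem normFun_loeb_le {y : Y U P} {a : X} (ha : IsStY R P y a) :
    normFun (loebSets U (quotMeasure μ P)) (loebMeasure U (quotMeasure μ P)) y ≤
      normFun R μ a := by
  induction y using product_induction with | h y => ?_
  refine le_normFun fun A hA haA => ?_
  refine le_of_tendsto ((hP.isHyperfiniteMeasure hR hμ hns).tendsto_normFun_loeb y)
    ((eventually_subset_of_isStY ha hA haA).mono fun i hi => ?_)
  rw [quotMeasure_singleton]
  exact enorm_le_setNorm (hP.classes_mem i _ (y i).2) hi

include hsep

theorem funNorm_compStY_sub_le (f : X → K) (g : SimpleFun R K) :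
    funNorm (loebSets U (quotMeasure μ P)) (loebMeasure U (quotMeasure μ P))
      (fun y => compStY U R P f y - (hP.compSimple g).toFun y) ≤
      funNorm R μ (fun x => f x - g.toFun x) := by
  refine iSup_le fun y => ?_
  by_cases h : ∃ a, IsStY R P y a
  · obtain ⟨a, ha⟩ := h
    simp only [compStY_eq hsep hR f ha, hP.toFun_compSimple hsep hR g ha]
    exact (mul_le_mul_right (hP.normFun_loeb_le hR hμ hns ha) _).trans
      (le_funNorm R μ (fun x => f x - g.toFun x) a)
  · simp [compStY_of_not_exists f h, hP.toFun_compSimple_of_not_exists g h]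

theorem approximates_compSimple {f : X → K} {g : ℕ → SimpleFun R K} (hg : Approximates R μ g f) :
    Approximates (loebSets U (quotMeasure μ P)) (loebMeasure U (quotMeasure μ P))
      (fun n => hP.compSimple (g n)) (compStY U R P f) :=
  tendsto_of_tendsto_of_tendsto_of_le_of_le tendsto_const_nhds hg (fun _ => zero_le)
    fun n => hP.funNorm_compStY_sub_le hR hsep hμ hns f (g n)

theorem isIntegrable_compStY {f : X → K} (hf : IsIntegrable R μ f) :
    IsIntegrable (loebSets U (quotMeasure μ P)) (loebMeasure U (quotMeasure μ P))
      (compStY U R P f) := by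
  obtain ⟨g, hg⟩ := hf
  exact ⟨_, hP.approximates_compSimple hR hsep hμ hns hg⟩

theorem integral_compStY [CompleteSpace K] {f : X → K} (hf : IsIntegrable R μ f) :
    integral (loebSets U (quotMeasure μ P)) (loebMeasure U (quotMeasure μ P))
      (compStY U R P f) = integral R μ f := by
  obtain ⟨g, hg⟩ := hf
  refine tendsto_nhds_unique ((hP.isHyperfiniteMeasure hR hμ hns).isNormControlled.tendsto_integral
    (hP.approximates_compSimple hR hsep hμ hns hg)) ?_
  simp_rw [hP.integral_compSimple]
  exact (hμ.isNormControlled hR).tendsto_integral hg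

end IsPushDown

/-! ### The lifting `*f ∘ p` -/

theorem exists_simpleFun_funNorm_le {f : X → K} (hf : IsIntegrable R μ f) {ε : ℝ≥0∞}
    (hε : 0 < ε) : ∃ g : SimpleFun R K, funNorm R μ (fun x => f x - g.toFun x) ≤ ε := by
  obtain ⟨g, hg⟩ := hf
  obtain ⟨n, hn⟩ := (ENNReal.tendsto_nhds_zero.1 hg ε hε).exists
  exact ⟨g n, hn⟩

section Lifting

variable [IsUltrametricDist K] {p : ∀ i, Cls P i → X}

omit [IsUltrametricDist K] in
-- This is what the representatives are chosen for: an approximation in the seminorm of μ becomes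
-- one of the lifting, uniform in the class.
theorem enorm_sub_mul_le (hp : ∀ i (C : Cls P i), p i C ∈ (C : Set X) ∧
      ‖μ (C : Set X)‖ₑ ≤ 2 * normFun R μ (p i C)) (f g : X → K) (i : I) (C : Cls P i) :
    ‖f (p i C) - g (p i C)‖ₑ * ‖μ (C : Set X)‖ₑ ≤ 2 * funNorm R μ (fun x => f x - g x) := by
  refine (mul_le_mul_right (hp i C).2 _).trans ?_
  rw [mul_left_comm]
  exact mul_le_mul_right (le_funNorm R μ (fun x => f x - g x) (p i C)) _

theorem enorm_mul_le_max (hp : ∀ i (C : Cls P i), p i C ∈ (C : Set X) ∧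
      ‖μ (C : Set X)‖ₑ ≤ 2 * normFun R μ (p i C)) (f g : X → K) (i : I) (C : Cls P i) :
    ‖f (p i C)‖ₑ * ‖μ (C : Set X)‖ₑ ≤
      max (2 * funNorm R μ (fun x => f x - g x)) (‖g (p i C)‖ₑ * ‖μ (C : Set X)‖ₑ) := by
  have := enorm_add_le_max' (f (p i C) - g (p i C)) (g (p i C))
  rw [sub_add_cancel] at this
  refine (mul_le_mul_left this _).trans ?_
  rw [max_mul]
  exact max_le_max (enorm_sub_mul_le hp f g i C) le_rfl

variable (hP : IsPushDown U R μ P) (hR : MeasureTheory.IsSetAlgebra R) (hμ : IsMeasure R μ)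
  (hns : HasNearstandardValues U R μ) (hp : ∀ i (C : Cls P i), p i C ∈ (C : Set X) ∧
      ‖μ (C : Set X)‖ₑ ≤ 2 * normFun R μ (p i C))

include hP hR hμ hns hp

theorem isSIntegrable_lifting {f : X → K} (hf : IsIntegrable R μ f) :
    IsSIntegrable U (quotMeasure μ P) fun i C => f (p i C) := by
  have hν := hP.isHyperfiniteMeasure hR hμ hns
  have hS := hμ.bounded Set.univ hR.univ_mem
  have hle : ∀ i (C : Cls P i), ‖μ (C : Set X)‖ₑ ≤ setNorm R μ Set.univ := fun i C =>
    enorm_le_setNorm (hP.classes_mem i C C.2) (Set.subset_univ _)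
  refine ⟨?_, fun A hA => ?_, fun A hA => ?_⟩
  -- A simple `g` at distance at most 1 gives the bound `max 2 (M * S)`, with `M` a bound of `g` and
  -- `S` the norm of the whole space.
  · obtain ⟨g, hg⟩ := exists_simpleFun_funNorm_le hf one_pos
    obtain ⟨M, hM⟩ := g.exists_enorm_toFun_le
    lift setNorm R μ Set.univ to ℝ≥0 using hS.ne with S
    refine ⟨max 2 (M * S), Eventually.of_forall fun i => iSup_le fun C => ?_⟩
    rw [hν.normFun_eq, quotMeasure_singleton]
    refine (enorm_mul_le_max hp f g.toFun i C).trans ?_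
    push_cast
    refine max_le_max ?_ (mul_le_mul' (hM _) (hle i C))
    simpa using mul_le_mul_right hg 2
  · rw [starSetNorm, infinitesimal_coe_iff] at hA
    rw [starFunNorm, infinitesimal_coe_iff, ENNReal.tendsto_nhds_zero]
    intro ε hε
    -- The half absorbs the factor 2 of the representatives. The simple part is at most `M` times
    -- the norm of `A`, which is infinitesimal.
    obtain ⟨g, hg⟩ := exists_simpleFun_funNorm_le hf (ENNReal.half_pos hε.ne')
    obtain ⟨M, hM⟩ := g.exists_enorm_toFun_le
    have hMA := ENNReal.Tendsto.const_mul (a := (M : ℝ≥0∞)) hA (Or.inr ENNReal.coe_ne_top)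
    rw [mul_zero] at hMA
    refine (ENNReal.tendsto_nhds_zero.1 hMA ε hε).mono fun i hi => iSup_le fun C => ?_
    by_cases hC : C ∈ A i
    · rw [Set.indicator_of_mem hC, hν.normFun_eq]
      have hCA : ‖quotMeasure μ P i {C}‖ₑ ≤ setNorm Set.univ (quotMeasure μ P i) (A i) :=
        enorm_le_setNorm (Set.mem_univ _) (Set.singleton_subset_iff.2 hC)
      rw [quotMeasure_singleton] at hCA ⊢
      refine (enorm_mul_le_max hp f g.toFun i C).trans (max_le ?_ ?_)
      · exact (mul_le_mul_right hg 2).trans_eq (ENNReal.mul_div_cancel (by simp) (by simp))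
      · exact (mul_le_mul' (hM _) hCA).trans hi
    · simp [Set.indicator_of_notMem hC]
  · rw [starFunNorm, infinitesimal_coe_iff]
    -- At each point an infinitesimal value is multiplied by a mass bounded by the norm of the whole
    -- space; uniformity is automatic.
    refine tendsto_iSup_of_forall_tendsto hν.nonempty fun y => ?_
    have hy : Tendsto (fun i => (A i).indicator (fun C => f (p i C)) (y i)) U (𝓝 0) :=
      coe_mem_monad_iff.1 (hA (productMk U y))
    have := ENNReal.Tendsto.mul_const (tendsto_zero_iff_enorm_tendsto_zero.1 hy)
      (Or.inr hS.ne)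
    rw [zero_mul] at this
    refine tendsto_of_tendsto_of_tendsto_of_le_of_le tendsto_const_nhds this
      (fun _ => zero_le) fun i => ?_
    dsimp only
    rw [hν.normFun_eq, quotMeasure_singleton]
    exact mul_le_mul_right (hle i (y i)) _

theorem tendsto_lifting {f : X → K} (hf : IsIntegrable R μ f) {y : ∀ i, Cls P i} {a : X}
    (ha : IsStY R P (productMk U y) a)
    (hN : normFun (loebSets U (quotMeasure μ P)) (loebMeasure U (quotMeasure μ P))
      (productMk U y) ≠ 0) :
    Tendsto (fun i => f (p i (y i))) U (𝓝 (f a)) := by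
  have hν := hP.isHyperfiniteMeasure hR hμ hns
  -- `δ` bounds from below both `N` at `a` and, eventually, the mass of `y i`. Dividing a seminorm
  -- error of `ε * δ / 2` by it gives an error of at most `ε` at `a` and at `p i (y i)`.
  obtain ⟨δ, hδ, hδN⟩ := exists_between (pos_iff_ne_zero.2 hN)
  have hδa := hδN.le.trans (hP.normFun_loeb_le hR hμ hns ha)
  rw [← tendsto_sub_nhds_zero_iff, tendsto_zero_iff_enorm_tendsto_zero,
    ENNReal.tendsto_nhds_zero]
  intro ε hε
  have hεδ : 0 < ε * δ := ENNReal.mul_pos hε.ne' hδ.ne'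
  obtain ⟨g, hg⟩ := exists_simpleFun_funNorm_le hf (ENNReal.half_pos hεδ.ne')
  -- The finitely many sets of `g` are clopen, so `g` eventually takes the same value at `p i (y i)`
  -- and `a`.
  have hga : ∀ᶠ i in U, ∀ j, p i (y i) ∈ g.sets j ↔ a ∈ g.sets j := eventually_all.2 fun j => by
    by_cases hj : a ∈ g.sets j
    · exact (eventually_subset_of_isStY ha (g.mem j) hj).mono fun i hi =>
        iff_of_true (hi (hp i _).1) hj
    · exact (eventually_subset_of_isStY ha (hR.compl_mem (g.mem j)) hj).mono fun i hi =>
        iff_of_false (hi (hp i _).1) hj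
  filter_upwards [hga, (hν.tendsto_normFun_loeb y).eventually_const_lt hδN] with i hi hiδ
  rw [quotMeasure_singleton] at hiδ
  have hcancel : ∀ {r : ℝ≥0∞}, r * δ ≤ ε * δ → r ≤ ε := fun h =>
    (ENNReal.mul_le_mul_iff_left hδ.ne' hδN.ne_top).1 h
  have h1 : ‖f (p i (y i)) - g.toFun (p i (y i))‖ₑ ≤ ε := hcancel <|
    (mul_le_mul_right hiδ.le _).trans <| (enorm_sub_mul_le hp f g.toFun i (y i)).trans <|
      (mul_le_mul_right hg 2).trans_eq (ENNReal.mul_div_cancel (by simp) (by simp))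
  have h2 : ‖f a - g.toFun a‖ₑ ≤ ε := hcancel <|
    (mul_le_mul_right hδa _).trans <| (le_funNorm R μ (fun x => f x - g.toFun x) a).trans <|
      hg.trans ENNReal.half_le_self
  have h3 : f (p i (y i)) - f a =
      (f (p i (y i)) - g.toFun (p i (y i))) - (f a - g.toFun a) := by
    rw [g.toFun_congr hi]
    ring
  rw [h3]
  exact (enorm_sub_le_max _ _).trans (max_le h1 h2)

theorem isLoebNull_not_lifting {f : X → K} (hf : IsIntegrable R μ f) :
    IsLoebNull (U := U) (quotMeasure μ P)
      {y | ¬ ∃ x, IsStY R P y x ∧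
        starMap (fun i C => f (p i C)) y ∈ monad inferInstance (f x)} := by
  have hν := hP.isHyperfiniteMeasure hR hμ hns
  rw [hν.isLoebNull_iff]
  intro y hy
  by_contra hN
  by_cases h : ∃ a, IsStY R P y a
  · obtain ⟨a, ha⟩ := h
    induction y using product_induction with | h y => ?_
    exact hy ⟨a, ha, coe_mem_monad_iff.2 (tendsto_lifting hP hR hμ hns hp hf ha hN)⟩
  · exact hN (hν.isLoebNull_iff.1 hP.ae_defined y h)

theorem stK_lifting (hsep : IsSeparating R) {f : X → K} (hf : IsIntegrable R μ f) (y : Y U P)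
    (hN : normFun (loebSets U (quotMeasure μ P)) (loebMeasure U (quotMeasure μ P)) y ≠ 0) :
    stK (starMap (fun i C => f (p i C)) y) = compStY U R P f y := by
  have hν := hP.isHyperfiniteMeasure hR hμ hns
  by_cases h : ∃ a, IsStY R P y a
  · obtain ⟨a, ha⟩ := h
    rw [compStY_eq hsep hR f ha]
    induction y using product_induction with | h y => ?_
    exact stK_coe (tendsto_lifting hP hR hμ hns hp hf ha hN)
  · exact absurd (hν.isLoebNull_iff.1 hP.ae_defined y h) hN

omit [IsUltrametricDist K] hP hμ hns in
theorem stYPreimage_symmDiff_internalSet_subset {A : Set X} (hA : A ∈ R) :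
    symmDiff (stYPreimage U R P A) (internalSet U fun i => {C : Cls P i | p i C ∈ A}) ⊆
      {y | ¬ ∃ a, IsStY R P y a} := by
  rintro y hy ⟨a, ha⟩
  induction y using product_induction with | h y => ?_
  rcases hy with ⟨⟨b, hb, hyb⟩, hy⟩ | ⟨hy, hyA⟩
  · exact hy (coe_mem_internalSet.2
      ((eventually_subset_of_isStY hyb hA hb).mono fun i hi => hi (hp i _).1))
  · have haA : a ∉ A := fun h => hyA ⟨a, h, ha⟩
    obtain ⟨i, hi, hi'⟩ := ((coe_mem_internalSet.1 hy).and
      (eventually_subset_of_isStY ha (hR.compl_mem hA) haA)).exists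
    exact hi' (hp i _).1 hi

/-- By linearity it suffices to treat one set `A` of `g`. The classes with representative in `A`
form an internal set that approximates the preimage of `A` under st_Y, whose Loeb measure is `μ A`
by the push-down hypothesis. -/
theorem tendsto_sum_simpleFun (g : SimpleFun R K) :
    Tendsto (fun i => ∑ C : Cls P i, g.toFun (p i C) * quotMeasure μ P i {C}) U
      (𝓝 (g.integral μ)) := by
  classical
  have hν := hP.isHyperfiniteMeasure hR hμ hns
  have hj : ∀ j, Tendsto (fun i => quotMeasure μ P i {C : Cls P i | p i C ∈ g.sets j}) U
      (𝓝 (μ (g.sets j))) := fun j => by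
    rw [← hP.loebMeasure_stYPreimage (g.mem j)]
    exact hν.tendsto_loebMeasure (isLoebNull_mono hP.ae_defined
      (stYPreimage_symmDiff_internalSet_subset hR hp (g.mem j)))
  refine (tendsto_finsetSum Finset.univ fun j _ => (hj j).const_mul (g.coef j)).congr fun i => ?_
  simp_rw [SimpleFun.toFun, Finset.sum_mul]
  rw [Finset.sum_comm]
  refine Finset.sum_congr rfl fun j _ => ?_
  have := hν.measure_eq_sum i (Finset.univ.filter fun C => p i C ∈ g.sets j)
  rw [Finset.coe_filter_univ] at this
  rw [this, Finset.mul_sum, Finset.sum_filter]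
  refine Finset.sum_congr rfl fun C _ => ?_
  by_cases h : p i C ∈ g.sets j <;> simp [h]

theorem tendsto_sum_lifting [CompleteSpace K] {f : X → K} (hf : IsIntegrable R μ f) :
    Tendsto (fun i => ∑ C : Cls P i, f (p i C) * quotMeasure μ P i {C}) U
      (𝓝 (integral R μ f)) := by
  obtain ⟨g, hg⟩ := hf
  have hint := (hμ.isNormControlled hR).tendsto_integral hg
  rw [← tendsto_sub_nhds_zero_iff, tendsto_zero_iff_enorm_tendsto_zero,
    ENNReal.tendsto_nhds_zero] at hint ⊢
  intro ε hε
  obtain ⟨n, hn, hn'⟩ := ((hint ε hε).and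
    (ENNReal.tendsto_nhds_zero.1 hg (ε / 2) (ENNReal.half_pos hε.ne'))).exists
  have hs := tendsto_sum_simpleFun hP hR hμ hns hp (g n)
  rw [← tendsto_sub_nhds_zero_iff, tendsto_zero_iff_enorm_tendsto_zero,
    ENNReal.tendsto_nhds_zero] at hs
  refine (hs ε hε).mono fun i hi => ?_
  -- The ultrametric inequality makes this bound independent of the number of classes.
  have h1 : ‖∑ C : Cls P i, (f (p i C) - (g n).toFun (p i C)) * quotMeasure μ P i {C}‖ₑ ≤ ε :=
    enorm_sum_le_of_forall_le _ _ _ fun C _ => by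
      rw [enorm_mul, quotMeasure_singleton]
      exact (enorm_sub_mul_le hp f (g n).toFun i C).trans
        ((mul_le_mul_right hn' 2).trans_eq (ENNReal.mul_div_cancel (by simp) (by simp)))
  have h2 : ∑ C : Cls P i, f (p i C) * quotMeasure μ P i {C} - integral R μ f =
      ∑ C : Cls P i, (f (p i C) - (g n).toFun (p i C)) * quotMeasure μ P i {C} +
      ((∑ C : Cls P i, (g n).toFun (p i C) * quotMeasure μ P i {C} - (g n).integral μ) +
        ((g n).integral μ - integral R μ f)) := by
    simp_rw [sub_mul, Finset.sum_sub_distrib]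
    ring
  rw [h2]
  exact (enorm_add_le_max' _ _).trans
    (max_le h1 ((enorm_add_le_max' _ _).trans (max_le hi hn)))

end Lifting

end Quotient

end NonArch

theorem mainTheorem4 {X K I : Type*} [NontriviallyNormedField K] [CompleteSpace K]
    [IsUltrametricDist K] (U : Ultrafilter I) (hU : IsCountablyIncomplete U)
    (𝒜 : Set (Set X)) (h𝒜 : MeasureTheory.IsSetAlgebra 𝒜) (hsep : IsSeparating 𝒜)
    (μ : Set X → K) (hμ : IsMeasure 𝒜 μ) (hns : HasNearstandardValues U 𝒜 μ)
    (P : I → Finpartition (Set.univ : Set X)) (hP : IsPushDown U 𝒜 μ P)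
    (f : X → K) (hf : IsIntegrable 𝒜 μ f) :
    let ν := quotMeasure μ P
    IsIntegrable (loebSets U ν) (loebMeasure U ν) (compStY U 𝒜 P f) ∧
    ∃ F : ∀ i, Cls P i → K,
      IsSIntegrable U ν F ∧
      IsLoebNull (U := U) ν
        {y | ¬ ∃ x, IsStY 𝒜 P y x ∧ starMap F y ∈ monad inferInstance (f x)} ∧
      IsIntegrable (loebSets U ν) (loebMeasure U ν) (fun y => stK (starMap F y)) ∧
      IsNearstandard (starIntegral U ν F) ∧
      integral 𝒜 μ f = integral (loebSets U ν) (loebMeasure U ν) (compStY U 𝒜 P f) ∧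
      integral (loebSets U ν) (loebMeasure U ν) (compStY U 𝒜 P f) =
        integral (loebSets U ν) (loebMeasure U ν) (fun y => stK (starMap F y)) ∧
      integral (loebSets U ν) (loebMeasure U ν) (fun y => stK (starMap F y)) =
        stK (starIntegral U ν F) := by
  intro ν
  obtain ⟨p, hp⟩ := exists_representatives (hμ.isNormControlled h𝒜) hP.classes_mem
  have hcomp := hP.isIntegrable_compStY h𝒜 hsep hμ hns hf
  have hint := hP.integral_compStY h𝒜 hsep hμ hns hf
  -- The standard part of the lifting equals f ∘ st_Y wherever the Loeb norm function is nonzero, so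
  -- both have the same integrability and integral.
  have hst := stK_lifting hP h𝒜 hμ hns hp hsep hf
  have hsum := tendsto_sum_lifting hP h𝒜 hμ hns hp hf
  refine ⟨hcomp, fun i C => f (p i C), isSIntegrable_lifting hP h𝒜 hμ hns hp hf,
    isLoebNull_not_lifting hP h𝒜 hμ hns hp hf, (isIntegrable_congr hst).2 hcomp,
    ⟨_, coe_mem_monad_iff.2 hsum⟩, hint.symm, (integral_congr hst).symm, ?_⟩
  rw [integral_congr hst, hint]
  exact (stK_coe hsum).symm
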